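/- Let $\mathcal H_1,\dots,\mathcal H_K$ be finite-dimensional complex Hilbert spaces and $\mathcal H=\mathcal H_1\otimes\cdots\otimes\mathcal H_K$. A (discrete) POVM on a Hilbert space of dimension $d$ is a family $M=(M_x)_{x\in\mathcal X}$ of positive semidefinite operators with $\sum_x M_x=\mathbb 1$; it is a $t$-design if every $M_x$ has rank one and, with $p_x=\frac1d\operatorname{tr}M_x$ and $P_x=M_x/\operatorname{tr}M_x$, $$\sum_{x\in\mathcal X}p_x\,P_x^{\otimes t}=\int d\psi\;|\psi\rangle\langle\psi|^{\otimes t},$$ the integral being over the uniform (unitarily invariant) probability measure on pure states. For a POVM $M$ put $\|\Delta\|_M=\sum_x|\operatorname{tr}(\Delta M_x)|$, and for an operator $\Delta$ on $\mathcal H$ put $$\|\Delta\|_{2(K)}=\sqrt{\sum_{I\subseteq[K]}\operatorname{tr}\bigl|\operatorname{tr}_I\Delta\bigr|^2},$$ where $\operatorname{tr}_I$ is the partial trace over the parties in $I$ and $|A|^2=A^\dagger A$. Theorem. For each $j$ let $M^{(j)}=(M^{(j)}_x)_{x\in\mathcal X_j}$ be a POVM on $\mathcal H_j$ that is a $4$-design,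 and let $M=M^{(1)}\otimes\cdots\otimes M^{(K)}$ be the POVM on $\mathcal H$ with elements $M^{(1)}_{x_1}\otimes\cdots\otimes M^{(K)}_{x_K}$. Then for every Hermitian operator $\Delta$ on $\mathcal H$, $$\Bigl(\tfrac{1}{\sqrt{18}}\Bigr)^{K}\,\|\Delta\|_{2(K)}\;\le\;\|\Delta\|_M\;\le\;\|\Delta\|_{2(K)}.$$ -/

import Mathlib

namespace DesignPOVM

noncomputable section

open MeasureTheory
open scoped ComplexOrder

/-! Operators on the Hilbert space `ℂⁿ` are matrices indexed by a finite type `n` (an orthonormal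
basis); operators on the tensor product of the spaces `ℂ^(n j)` are matrices indexed by
`∀ j, n j` (the product basis). -/

/-- The tensor product `⨂ j, A j` of operators `A j` on `ℂ^(n j)`, as an operator on the tensor
product of these spaces. -/
def tensorProd {ι : Type*} [Fintype ι] {n : ι → Type*} (A : ∀ j, Matrix (n j) (n j) ℂ) :
    Matrix (∀ j, n j) (∀ j, n j) ℂ :=
  Matrix.of fun a b => ∏ j, A j (a j) (b j)

/-- The tensor power `A^{⊗ t}`. -/
def tensorPow {n : Type*} (A : Matrix n n ℂ) (t : ℕ) : Matrix (Fin t → n) (Fin t → n) ℂ :=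
  tensorProd fun _ : Fin t => A

/-- The projector `|ψ⟩⟨ψ|` onto the line spanned by a unit vector `ψ`. -/
def pureState {n : Type*} [Fintype n] (ψ : Metric.sphere (0 : EuclideanSpace ℂ n) 1) :
    Matrix n n ℂ :=
  Matrix.of fun a b => ψ.1 a * star (ψ.1 b)

/-- The uniform (unitarily invariant) probability measure on the unit vectors of `ℂⁿ`: surface
measure on the unit sphere, divided by its total mass. -/
def uniformPure (n : Type*) [Fintype n] :
    Measure (Metric.sphere (0 : EuclideanSpace ℂ n) 1) :=
  ((volume : Measure (EuclideanSpace ℂ n)).toSphere Set.univ)⁻¹ •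
    (volume : Measure (EuclideanSpace ℂ n)).toSphere

/-- The operator `∫ dψ |ψ⟩⟨ψ|^{⊗ t}`; the integral of an operator-valued function is taken
entrywise. -/
def uniformMoment (n : Type*) [Fintype n] (t : ℕ) : Matrix (Fin t → n) (Fin t → n) ℂ :=
  Matrix.of fun a b => ∫ ψ, tensorPow (pureState ψ) t a b ∂(uniformPure n)

/-- A discrete POVM: positive semidefinite operators `M x` with `∑ x, M x = 1`.
The outcome set `X` may be infinite; the sum is then required to converge. -/
structure IsPOVM {n X : Type*} [Fintype n] [DecidableEq n] (M : X → Matrix n n ℂ) : Prop where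
  posSemidef : ∀ x, (M x).PosSemidef
  hasSum_one : HasSum M 1

/-- A `t`-design POVM: a rank-one POVM such that, with `p x = tr (M x) / d` and
`P x = M x / tr (M x)`, one has `∑ x, p x • (P x)^{⊗ t} = ∫ dψ |ψ⟩⟨ψ|^{⊗ t}`. -/
structure IsDesign {n X : Type*} [Fintype n] [DecidableEq n] (t : ℕ)
    (M : X → Matrix n n ℂ) : Prop extends IsPOVM M where
  rank_one : ∀ x, (M x).rank = 1
  hasSum_design :
    HasSum (fun x => ((M x).trace / (Fintype.card n : ℂ)) •
      tensorPow ((M x).trace⁻¹ • M x) t) (uniformMoment n t)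

/-- The tensor product `M 1 ⊗ ⋯ ⊗ M K` of POVMs: its elements are all the tensor products
`M 1 (x 1) ⊗ ⋯ ⊗ M K (x K)`. -/
def tensorPOVM {ι : Type*} [Fintype ι] {n X : ι → Type*}
    (M : ∀ j, X j → Matrix (n j) (n j) ℂ) :
    (∀ j, X j) → Matrix (∀ j, n j) (∀ j, n j) ℂ :=
  fun x => tensorProd fun j => M j (x j)

/-- The measurement norm `‖Δ‖_M = ∑ x, |tr (Δ M x)|`. -/
def measurementNorm {n X : Type*} [Fintype n] (M : X → Matrix n n ℂ) (Δ : Matrix n n ℂ) : ℝ :=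
  ∑' x, ‖(Δ * M x).trace‖

/-- The partial trace `tr_I Δ` over the parties in `I`, an operator on the tensor product of the
remaining spaces. -/
def partialTrace {ι : Type*} [Fintype ι] [DecidableEq ι] {n : ι → Type*} [∀ j, Fintype (n j)]
    (I : Finset ι) (Δ : Matrix (∀ j, n j) (∀ j, n j) ℂ) :
    Matrix (∀ j : {j // ¬ j ∈ I}, n j) (∀ j : {j // ¬ j ∈ I}, n j) ℂ :=
  Matrix.of fun a b => ∑ c : (∀ j : {j // j ∈ I}, n j),
    Δ ((Equiv.piEquivPiSubtypeProd (fun j => j ∈ I) n).symm (c, a))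
      ((Equiv.piEquivPiSubtypeProd (fun j => j ∈ I) n).symm (c, b))

/-- The multipartite 2-norm `‖Δ‖_{2(K)} = √(∑ I, tr |tr_I Δ|²)`, where `|A|² = Aᴴ A`. -/
def multiNorm {ι : Type*} [Fintype ι] [DecidableEq ι] {n : ι → Type*} [∀ j, Fintype (n j)]
    (Δ : Matrix (∀ j, n j) (∀ j, n j) ℂ) : ℝ :=
  √(∑ I : Finset ι, ((partialTrace I Δ).conjTranspose * partialTrace I Δ).trace.re)

end

end DesignPOVM

namespace DesignPOVM

open MeasureTheory
open scoped ComplexOrder BigOperators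

/-! Write $D=\prod_j d_j$ for the local dimensions $d_j$, let $w$ be the product of the weights
$p_x$, and let $s(x)=\operatorname{tr}(\Delta P_x)$ with $P_x$ the product of the normalised
effects. The measurement norm is $D\,\mathbb E_w|s|$, so moments suffice: $\mathbb E|s|\le(\mathbb E
s^2)^{1/2}$ gives the upper bound and $(\mathbb E|s|)^2\,\mathbb E s^4\ge(\mathbb E s^2)^3$ the
lower one.

For $t\le4$ the design property gives $\mathbb E s^t=\prod_j\frac1{d_j(d_j+1)\cdots(d_j+t-1)}$ times
a sum, over one permutation of the $t$ copies of $\Delta$ per tensor factor, of contractions of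
these copies (`hasSum_weight_mul_pow`). For $t=2$ each factor carries the identity or the swap, and
the sum is exactly $\|\Delta\|_{2(K)}^2$ (`sum_permContraction_two`).

For $t=4$ each contraction is at most
$\prod_i(\operatorname{tr}|\operatorname{tr}_{I_i}\Delta|^2)^{1/2}$, where $I_i$ is the set of
factors whose permutation fixes copy $i$ (`norm_permContraction_le`). AM-GM splits the four copies
into two pairs; at most 18 permutations have a given fixed-or-moved pattern on a pair, so the sum is
at most $18^K\|\Delta\|_{2(K)}^4$. -/

/-! ### Gaussian integrals and moments of the uniform measure on the sphere. -/

theorem integral_pow_mul_conj_pow_mul_exp_of_ne {p q : ℕ} (h : p ≠ q) :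
    ∫ z : ℂ, z ^ p * (starRingEnd ℂ z) ^ q * (Real.exp (-‖z‖ ^ 2) : ℂ) = 0 := by
  have hpq : (p : ℂ) - q ≠ 0 := sub_ne_zero.mpr (by exact_mod_cast h)
  -- Rotation by θ multiplies the monomial by $e^{i(p-q)\theta}=-1$ and preserves the Gaussian
  -- weight and the measure, so the integral equals its negative.
  let θ : ℝ := Real.pi / ((p : ℝ) - q)
  let u : Circle := Circle.exp θ
  have hu : (u : ℂ) ^ p * (starRingEnd ℂ (u : ℂ)) ^ q = -1 := by
    have : starRingEnd ℂ (u : ℂ) = Complex.exp (-(θ * Complex.I)) := by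
      rw [Circle.coe_exp, ← Complex.exp_conj]
      simp
    rw [this, Circle.coe_exp, ← Complex.exp_nat_mul, ← Complex.exp_nat_mul, ← Complex.exp_add,
      ← Complex.exp_pi_mul_I]
    congr 1
    simp only [θ]
    push_cast
    field_simp
    ring
  have hmp := (rotation u).measurePreserving
  have key := hmp.integral_comp (rotation u).toHomeomorph.measurableEmbedding
    (fun z : ℂ => z ^ p * (starRingEnd ℂ z) ^ q * (Real.exp (-‖z‖ ^ 2) : ℂ))
  have h2 : ∀ z : ℂ, (rotation u z) ^ p * (starRingEnd ℂ (rotation u z)) ^ q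
      * (Real.exp (-‖rotation u z‖ ^ 2) : ℂ)
      = -(z ^ p * (starRingEnd ℂ z) ^ q * (Real.exp (-‖z‖ ^ 2) : ℂ)) := by
    intro z
    rw [LinearIsometryEquiv.norm_map, rotation_apply, map_mul, mul_pow, mul_pow]
    linear_combination (z ^ p * (starRingEnd ℂ z) ^ q * (Real.exp (-‖z‖ ^ 2) : ℂ)) * hu
  simp only [h2, integral_neg] at key
  linear_combination (-1 / 2 : ℂ) * key

theorem integral_pow_mul_conj_pow_mul_exp (p : ℕ) :
    ∫ z : ℂ, z ^ p * (starRingEnd ℂ z) ^ p * (Real.exp (-‖z‖ ^ 2) : ℂ)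
      = Real.pi * (p.factorial : ℂ) := by
  have h1 : ∀ z : ℂ, z ^ p * (starRingEnd ℂ z) ^ p * (Real.exp (-‖z‖ ^ 2) : ℂ)
      = ((‖z‖ ^ ((2 * p : ℕ) : ℝ) * Real.exp (-‖z‖ ^ (2 : ℝ)) : ℝ) : ℂ) := by
    intro z
    rw [← mul_pow, Complex.mul_conj', Real.rpow_natCast, Real.rpow_two]
    push_cast
    ring
  simp only [h1]
  rw [integral_complex_ofReal, Complex.integral_rpow_mul_exp_neg_rpow (by norm_num)
    (lt_of_lt_of_le (by norm_num) (Nat.cast_nonneg _))]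
  have : (((2 * p : ℕ) : ℝ) + 2) / 2 = (p : ℝ) + 1 := by push_cast; ring
  rw [this, Real.Gamma_nat_eq_factorial]
  push_cast
  ring

/-- The number of permutations `σ` with `a ∘ σ = b`. -/
theorem sum_perm_prod_ite {n : Type*} [Fintype n] [DecidableEq n] {ι : Type*} [Fintype ι]
    [DecidableEq ι] (a b : ι → n) :
    (∑ σ : Equiv.Perm ι, ∏ i, if a (σ i) = b i then (1 : ℂ) else 0)
      = ∏ k, if (Fintype.card {i // a i = k} = Fintype.card {i // b i = k}) then
          ((Fintype.card {i // a i = k}).factorial : ℂ) else 0 := by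
  have h0 : ∀ σ : Equiv.Perm ι, (∏ i, if a (σ i) = b i then (1 : ℂ) else 0)
      = if a ∘ σ = b then 1 else 0 := by
    intro σ
    rw [Fintype.prod_ite_zero]
    simp [funext_iff]
  simp only [h0]
  by_cases h : ∀ k, Fintype.card {i // a i = k} = Fintype.card {i // b i = k}
  -- The solutions form a coset of the stabiliser of `a`, whose order is the product of the
  -- factorials of the fibre sizes.
  · obtain ⟨τ, rfl⟩ : ∃ τ : Equiv.Perm ι, b = a ∘ τ := by
      let e : ∀ k, {i // b i = k} ≃ {i // a i = k} := fun k => (Fintype.equivOfCardEq (h k)).symm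
      refine ⟨(Equiv.sigmaFiberEquiv b).symm.trans
        ((Equiv.sigmaCongrRight e).trans (Equiv.sigmaFiberEquiv a)), ?_⟩
      ext i
      exact ((e (b i) ⟨i, rfl⟩).2).symm
    have h1 : ∀ σ : Equiv.Perm ι, a ∘ (σ * τ : Equiv.Perm ι) = a ∘ τ ↔ a ∘ σ = a := fun σ => by
      rw [Equiv.Perm.coe_mul, ← Function.comp_assoc]
      exact τ.surjective.injective_comp_right.eq_iff
    rw [Finset.prod_congr rfl (fun k _ => if_pos (h k)), ← Nat.cast_prod,
      ← DomMulAct.stabilizer_card a, Fintype.card_subtype,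
      ← Equiv.sum_comp (Equiv.mulRight τ)]
    simp only [Equiv.coe_mulRight, h1]
    rw [Finset.sum_boole]
  · have h' := h
    push Not at h
    obtain ⟨k, hk⟩ := h
    rw [Finset.prod_eq_zero (Finset.mem_univ k) (if_neg hk)]
    refine Finset.sum_eq_zero fun σ _ => if_neg ?_
    rintro rfl
    refine hk (Fintype.card_congr ?_)
    exact (σ.subtypeEquiv (fun i => by simp)).symm

theorem integral_prod_mul_conj_mul_exp {n : Type*} [Fintype n] [DecidableEq n] {ι : Type*}
    [Fintype ι] [DecidableEq ι] (a b : ι → n) :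
    ∫ z : n → ℂ, (∏ i, z (a i) * starRingEnd ℂ (z (b i))) * (Real.exp (-∑ k, ‖z k‖ ^ 2) : ℂ)
      = Real.pi ^ Fintype.card n
        * ∑ σ : Equiv.Perm ι, ∏ i, if a (σ i) = b i then (1 : ℂ) else 0 := by
  have h1 : ∀ z : n → ℂ, (∏ i, z (a i) * starRingEnd ℂ (z (b i)))
        * (Real.exp (-∑ k, ‖z k‖ ^ 2) : ℂ)
      = ∏ k, (z k ^ Fintype.card {i // a i = k}
          * (starRingEnd ℂ (z k)) ^ Fintype.card {i // b i = k} * (Real.exp (-‖z k‖ ^ 2) : ℂ)) := by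
    intro z
    rw [Finset.prod_mul_distrib, Finset.prod_mul_distrib, Finset.prod_mul_distrib,
      ← Finset.sum_neg_distrib, Real.exp_sum, Complex.ofReal_prod]
    congr 2
    · rw [← Finset.prod_fiberwise' Finset.univ a (fun k => z k)]
      simp [Fintype.card_subtype]
    · rw [← Finset.prod_fiberwise' Finset.univ b (fun k => starRingEnd ℂ (z k))]
      simp [Fintype.card_subtype]
  simp only [h1]
  rw [integral_fintype_prod_volume_eq_prod (fun k (w : ℂ) => w ^ Fintype.card {i // a i = k}
          * (starRingEnd ℂ w) ^ Fintype.card {i // b i = k} * (Real.exp (-‖w‖ ^ 2) : ℂ)),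
    sum_perm_prod_ite, ← Finset.card_univ, ← Finset.prod_const, ← Finset.prod_mul_distrib]
  refine Finset.prod_congr rfl fun k _ => ?_
  split_ifs with h
  · rw [← h, integral_pow_mul_conj_pow_mul_exp]
  · rw [integral_pow_mul_conj_pow_mul_exp_of_ne h, mul_zero]

/-- Uniqueness of Haar measure; the constant cancels when the sphere is normalised. -/
theorem exists_integral_euclideanSpace_eq (n : Type*) [Fintype n] :
    ∃ c : ℝ, c ≠ 0 ∧ ∀ f : EuclideanSpace ℂ n → ℂ,
      ∫ z, f z = c • ∫ z : n → ℂ, f (WithLp.toLp 2 z) := by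
  let e : (n → ℂ) ≃L[ℝ] EuclideanSpace ℂ n :=
    ((PiLp.continuousLinearEquiv 2 ℝ (fun _ : n => ℂ)).symm)
  let μ : Measure (EuclideanSpace ℂ n) := (volume : Measure (n → ℂ)).map e
  have hμ : μ.IsAddHaarMeasure := e.isAddHaarMeasure_map volume
  refine ⟨Measure.addHaarScalarFactor volume μ, ?_, fun f => ?_⟩
  · exact_mod_cast (Measure.addHaarScalarFactor_pos_of_isAddHaarMeasure volume μ).ne'
  · have h := Measure.isAddLeftInvariant_eq_smul (volume : Measure (EuclideanSpace ℂ n)) μ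
    conv_lhs => rw [h]
    rw [integral_smul_nnreal_measure]
    exact congrArg _ (e.toHomeomorph.measurableEmbedding.integral_map f)

theorem integral_eq_integral_sphere_prod {E F : Type*} [NormedAddCommGroup E] [NormedSpace ℝ E]
    [MeasurableSpace E] [BorelSpace E] [FiniteDimensional ℝ E] [Nontrivial E]
    [NormedAddCommGroup F] [NormedSpace ℝ F] (μ : Measure E) [μ.IsAddHaarMeasure] (g : E → F) :
    ∫ z, g z ∂μ = ∫ p : Metric.sphere (0 : E) 1 × Set.Ioi (0 : ℝ), g ((p.2 : ℝ) • (p.1 : E))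
      ∂(μ.toSphere.prod (.volumeIoiPow (Module.finrank ℝ E - 1))) := by
  rw [← μ.measurePreserving_homeomorphUnitSphereProd.integral_comp
    (Homeomorph.measurableEmbedding _)]
  have h : ∀ x : ({0}ᶜ : Set E), ((homeomorphUnitSphereProd E x).2 : ℝ)
      • ((homeomorphUnitSphereProd E x).1 : E) = x := fun x => by
    rw [← homeomorphUnitSphereProd_symm_apply_coe, Homeomorph.symm_apply_apply]
  simp only [h]
  rw [integral_subtype_comap (measurableSet_singleton _).compl, restrict_compl_singleton]

theorem integral_volumeIoiPow_pow_mul_exp (m k : ℕ) :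
    ∫ r : Set.Ioi (0 : ℝ), (((r : ℝ) ^ k * Real.exp (-(r : ℝ) ^ 2) : ℝ) : ℂ)
      ∂(Measure.volumeIoiPow m) = ((1 / 2 * Real.Gamma (((m + k : ℕ) + 1) / 2) : ℝ) : ℂ) := by
  rw [integral_complex_ofReal]
  congr 1
  simp only [Measure.volumeIoiPow, ENNReal.ofReal]
  rw [integral_withDensity_eq_integral_smul (measurable_subtype_coe.pow_const _).real_toNNReal,
    integral_subtype_comap measurableSet_Ioi
      fun a : ℝ ↦ Real.toNNReal (a ^ m) • (a ^ k * Real.exp (-a ^ 2)),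
    ← integral_rpow_mul_exp_neg_rpow (p := 2) (q := ((m + k : ℕ) : ℝ)) (by norm_num)
      (lt_of_lt_of_le (by norm_num) (Nat.cast_nonneg _))]
  refine setIntegral_congr_fun measurableSet_Ioi fun x hx => ?_
  simp only [NNReal.smul_def, Real.coe_toNNReal _ (pow_nonneg hx.out.le _), smul_eq_mul]
  rw [Real.rpow_natCast, Real.rpow_two, pow_add, mul_assoc]

/-- Polar coordinates: the monomial is homogeneous of degree $2|\iota|$ and the real dimension is
$2d$, so the radial integral is $\frac12\Gamma(d+|\iota|)$. -/
theorem integral_sphere_mul_gamma {n : Type*} [Fintype n] [DecidableEq n] [Nonempty n] {ι : Type*}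
    [Fintype ι] [DecidableEq ι] (a b : ι → n) :
    (∫ ψ : Metric.sphere (0 : EuclideanSpace ℂ n) 1,
        ∏ i, ψ.1 (a i) * starRingEnd ℂ (ψ.1 (b i))
        ∂(volume : Measure (EuclideanSpace ℂ n)).toSphere)
      * (1 / 2 * (Fintype.card n + Fintype.card ι - 1).factorial)
      = ∫ z : EuclideanSpace ℂ n, (∏ i, z (a i) * starRingEnd ℂ (z (b i)))
          * (Real.exp (-‖z‖ ^ 2) : ℂ) := by
  rw [integral_eq_integral_sphere_prod (volume : Measure (EuclideanSpace ℂ n))]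
  have h : ∀ p : Metric.sphere (0 : EuclideanSpace ℂ n) 1 × Set.Ioi (0 : ℝ),
      (∏ i, ((p.2 : ℝ) • p.1.1) (a i) * starRingEnd ℂ (((p.2 : ℝ) • p.1.1) (b i)))
          * (Real.exp (-‖(p.2 : ℝ) • p.1.1‖ ^ 2) : ℂ)
      = (∏ i, p.1.1 (a i) * starRingEnd ℂ (p.1.1 (b i)))
        * (((p.2 : ℝ) ^ (2 * Fintype.card ι) * Real.exp (-(p.2 : ℝ) ^ 2) : ℝ) : ℂ) := by
    rintro ⟨ψ, r, hr⟩
    have hψ : ‖ψ.1‖ = 1 := by simp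
    simp only [norm_smul, hψ, mul_one, Real.norm_eq_abs, sq_abs, PiLp.smul_apply,
      Complex.real_smul, map_mul, Complex.conj_ofReal]
    have : ∀ i, (r : ℂ) * ψ.1 (a i) * (r * starRingEnd ℂ (ψ.1 (b i)))
        = (r : ℂ) ^ 2 * (ψ.1 (a i) * starRingEnd ℂ (ψ.1 (b i))) := fun i => by ring
    simp only [this, Finset.prod_mul_distrib, Finset.prod_const, Finset.card_univ]
    push_cast
    ring
  simp only [h]
  rw [integral_prod_mul (fun ψ : Metric.sphere (0 : EuclideanSpace ℂ n) 1 =>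
      ∏ i, ψ.1 (a i) * starRingEnd ℂ (ψ.1 (b i))) (fun r : Set.Ioi (0 : ℝ) =>
        (((r : ℝ) ^ (2 * Fintype.card ι) * Real.exp (-(r : ℝ) ^ 2) : ℝ) : ℂ)),
    integral_volumeIoiPow_pow_mul_exp]
  congr 1
  have hd : 0 < Fintype.card n := Fintype.card_pos
  have hfin : Module.finrank ℝ (EuclideanSpace ℂ n) = 2 * Fintype.card n := by
    rw [← Module.finrank_mul_finrank ℝ ℂ, Complex.finrank_real_complex, finrank_euclideanSpace]
  have : (((Module.finrank ℝ (EuclideanSpace ℂ n) - 1 + 2 * Fintype.card ι : ℕ) : ℝ) + 1) / 2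
      = ((Fintype.card n + Fintype.card ι - 1 : ℕ) : ℝ) + 1 := by
    rw [hfin, Nat.cast_sub (by omega), Nat.cast_add, Nat.cast_sub (by omega)]
    push_cast
    ring
  rw [this, Real.Gamma_nat_eq_factorial]
  push_cast
  ring

/-- The moments of the uniform measure on pure states. -/
theorem uniformMoment_apply {n : Type*} [Fintype n] [DecidableEq n] [Nonempty n] {t : ℕ}
    (a b : Fin t → n) :
    uniformMoment n t a b = ((Fintype.card n).ascFactorial t : ℂ)⁻¹
      * ∑ σ : Equiv.Perm (Fin t), ∏ i, if a (σ i) = b i then (1 : ℂ) else 0 := by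
  obtain ⟨c, hc, hE⟩ := exists_integral_euclideanSpace_eq n
  set d := Fintype.card n with hd
  have hdpos : 0 < d := Fintype.card_pos
  set m := (volume : Measure (EuclideanSpace ℂ n)).toSphere with hm
  have hgauss : ∀ {ι : Type} [Fintype ι] [DecidableEq ι] (a b : ι → n),
      (∫ ψ, ∏ i, ψ.1 (a i) * starRingEnd ℂ (ψ.1 (b i)) ∂m)
        * (1 / 2 * (d + Fintype.card ι - 1).factorial)
      = c * (Real.pi ^ d * ∑ σ : Equiv.Perm ι, ∏ i, if a (σ i) = b i then (1 : ℂ) else 0) := by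
    intro ι _ _ a b
    rw [hm, integral_sphere_mul_gamma, hE, Complex.real_smul, ← integral_prod_mul_conj_mul_exp]
    simp only [EuclideanSpace.norm_sq_eq]
  -- The empty moment is the total mass of the sphere; dividing by it removes $c$ and $\pi^d$.
  have h0 := hgauss (Fin.elim0 : Fin 0 → n) Fin.elim0
  have ht := hgauss a b
  simp only [Finset.univ_eq_empty, Finset.prod_empty, integral_const, Fintype.card_fin, add_zero,
    Finset.sum_const, Finset.card_univ, Fintype.card_perm, Nat.factorial_zero, one_smul,
    mul_one, Complex.real_smul] at h0 ht
  have hL : uniformMoment n t a b = ((m.real Set.univ : ℝ) : ℂ)⁻¹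
      * ∫ ψ, ∏ i, ψ.1 (a i) * starRingEnd ℂ (ψ.1 (b i)) ∂m := by
    simp only [uniformMoment, Matrix.of_apply, tensorPow, tensorProd, pureState, uniformPure]
    rw [integral_smul_measure, ENNReal.toReal_inv, Complex.real_smul, Complex.ofReal_inv]
    rfl
  have hfac : ((d + t - 1).factorial : ℂ) = (d - 1).factorial * d.ascFactorial t := by
    obtain ⟨e, he⟩ : ∃ e, d = e + 1 := ⟨d - 1, by omega⟩
    rw [he, show e + 1 + t - 1 = e + t by omega, Nat.add_sub_cancel, ← Nat.cast_mul,
      Nat.factorial_mul_ascFactorial]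
  have hasc : (d.ascFactorial t : ℂ) ≠ 0 := by
    intro h
    rw [h, mul_zero] at hfac
    exact Nat.factorial_ne_zero _ (by exact_mod_cast hfac)
  have hf0 : ((d - 1).factorial : ℂ) ≠ 0 := by exact_mod_cast Nat.factorial_ne_zero _
  have hc' : (c : ℂ) ≠ 0 := by exact_mod_cast hc
  have hpi : (Real.pi : ℂ) ^ d ≠ 0 := pow_ne_zero _ (by exact_mod_cast Real.pi_ne_zero)
  have hR : ((m.real Set.univ : ℝ) : ℂ) ≠ 0 := by
    intro h
    rw [h, zero_mul] at h0
    exact mul_ne_zero hc' hpi (by simpa using h0.symm)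
  rw [hL, inv_mul_eq_div, div_eq_iff hR, mul_assoc, eq_inv_mul_iff_mul_eq₀ hasc]
  rw [hfac] at ht
  refine mul_right_cancel₀ (mul_ne_zero (one_div_ne_zero two_ne_zero) hf0) ?_
  linear_combination ht - (∑ σ : Equiv.Perm (Fin t), ∏ i, if a (σ i) = b i then (1 : ℂ) else 0) * h0

/-! ### Moments of product designs as sums over permutations. -/

section
theorem hasSum_mul_prod {α β : Type*} {f : α → ℂ} {g : β → ℂ} {a b : ℂ} (hf : HasSum f a)
    (hg : HasSum g b) : HasSum (fun p : α × β => f p.1 * g p.2) (a * b) :=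
  hf.mul hg (summable_mul_of_summable_norm hf.summable.norm hg.summable.norm)

theorem hasSum_pi_prod {K : ℕ} {X : Fin K → Type*} (f : ∀ j, X j → ℂ) (s : Fin K → ℂ)
    (h : ∀ j, HasSum (f j) (s j)) :
    HasSum (fun x : ∀ j, X j => ∏ j, f j (x j)) (∏ j, s j) := by
  induction K with
  | zero => simp
  | succ K ih =>
    have h1 := ih (fun j => f j.succ) (fun j => s j.succ) (fun j => h j.succ)
    have h2 := hasSum_mul_prod (h 0) h1
    rw [← (Fin.consEquiv X).hasSum_iff, Fin.prod_univ_succ]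
    have h3 : (fun x : ∀ j, X j => ∏ j, f j (x j)) ∘ Fin.consEquiv X
        = fun p : X 0 × (∀ j : Fin K, X j.succ) => f 0 p.1 * ∏ j : Fin K, f j.succ (p.2 j) := by
      ext p
      simp [Fin.prod_univ_succ, Fin.consEquiv]
    rw [h3]
    exact h2

/-- Pure states have trace one, so tracing out a copy lowers the order by one. -/
theorem sum_uniformMoment_cons {n : Type*} [Fintype n] [DecidableEq n] [Nonempty n] {t : ℕ}
    (a b : Fin t → n) :
    ∑ c, uniformMoment n (t + 1) (Fin.cons c a) (Fin.cons c b) = uniformMoment n t a b := by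
  have : NeZero (volume : Measure (EuclideanSpace ℂ n)).toSphere :=
    ⟨Measure.toSphere_ne_zero _⟩
  have : IsProbabilityMeasure (uniformPure n) := by unfold uniformPure; infer_instance
  simp only [uniformMoment, Matrix.of_apply]
  rw [← integral_finsetSum]
  · congr 1
    ext ψ
    have hψ : ∑ c, pureState ψ c c = 1 := by
      have h : ‖ψ.1‖ ^ 2 = 1 := by simp
      rw [EuclideanSpace.norm_sq_eq] at h
      simp only [pureState, Matrix.of_apply, RCLike.star_def, Complex.mul_conj']
      exact_mod_cast h
    simp only [tensorPow, tensorProd, Matrix.of_apply, Fin.prod_univ_succ, Fin.cons_zero,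
      Fin.cons_succ]
    rw [← Finset.sum_mul, hψ, one_mul]
  · intro c _
    refine Continuous.integrable_of_hasCompactSupport ?_ (HasCompactSupport.of_compactSpace _)
    simp only [tensorPow, tensorProd, pureState, Matrix.of_apply]
    fun_prop

namespace IsDesign

variable {n X : Type*} [Fintype n] [DecidableEq n] {t : ℕ} {M : X → Matrix n n ℂ}

theorem trace_ne_zero (hM : IsDesign t M) (x : X) : (M x).trace ≠ 0 := by
  intro h
  have := (hM.posSemidef x).trace_eq_zero_iff.mp h
  have h1 := hM.rank_one x
  simp [this] at h1

/-- A $t$-design is an $s$-design for all $s\le t$: trace out the copies one at a time. -/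
theorem hasSum_weight_mul_prod [Nonempty n] (hM : IsDesign t M) {s : ℕ} (hs : s ≤ t)
    (a b : Fin s → n) :
    HasSum (fun x => (M x).trace / (Fintype.card n : ℂ) *
      ∏ i, ((M x).trace⁻¹ • M x) (a i) (b i)) (uniformMoment n s a b) := by
  induction hs using Nat.decreasingInduction with
  | self =>
    exact (Pi.hasSum.mp (Pi.hasSum.mp hM.hasSum_design a)) b
  | of_succ k hk ih =>
    rw [← sum_uniformMoment_cons]
    convert hasSum_sum (s := Finset.univ) fun c _ => ih (Fin.cons c a) (Fin.cons c b) using 2 with x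
    have htr : ∑ c, ((M x).trace⁻¹ • M x) c c = 1 := by
      rw [← inv_mul_cancel₀ (hM.trace_ne_zero x), ← smul_eq_mul, ← Matrix.trace_smul]
      rfl
    simp only [Fin.prod_univ_succ, Fin.cons_zero, Fin.cons_succ]
    rw [← Finset.mul_sum, ← Finset.sum_mul, htr, one_mul]

end IsDesign

/-- The contraction of copies of `Δ` along a tuple of permutations of the copies, one permutation
for each tensor factor. -/
def permContraction {ι : Type*} {n : ι → Type*} {κ : Type*} [Fintype κ] [DecidableEq κ]
    [Fintype ι] [DecidableEq ι] [∀ j, Fintype (n j)]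
    (Δ : Matrix (∀ j, n j) (∀ j, n j) ℂ) (σ : ι → Equiv.Perm κ) : ℂ :=
  ∑ a : κ → ∀ j, n j, ∏ i, Δ (fun j => a (σ j i) j) (a i)

variable {K : ℕ} {n : Fin K → Type*} [∀ j, Fintype (n j)] [∀ j, DecidableEq (n j)]
    {X : Fin K → Type*} {M : ∀ j, X j → Matrix (n j) (n j) ℂ}

/-- The deltas determine all row indices from the column indices, so a single sum survives. -/
theorem sum_prod_mul_prod_ite {t : ℕ} (Δ : Matrix (∀ j, n j) (∀ j, n j) ℂ)
    (σ : Fin K → Equiv.Perm (Fin t)) :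
    (∑ q : Fin t → (∀ j, n j) × (∀ j, n j), (∏ i, Δ (q i).1 (q i).2) *
      ∏ j, ∏ i, if (q (σ j i)).2 j = (q i).1 j then (1 : ℂ) else 0) = permContraction Δ σ := by
  rw [← (Equiv.arrowProdEquivProdArrow (Fin t) (fun _ => ∀ j, n j) (fun _ => ∀ j, n j)).symm.sum_comp,
    Fintype.sum_prod_type_right]
  refine Finset.sum_congr rfl fun a _ => ?_
  simp only [Equiv.arrowProdEquivProdArrow, Equiv.coe_fn_symm_mk]
  rw [Finset.sum_eq_single (fun i j => a (σ j i) j)]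
  · simp
  · intro b _ hb
    obtain ⟨i, hi⟩ := Function.ne_iff.mp hb
    obtain ⟨j, hj⟩ := Function.ne_iff.mp hi
    rw [Finset.prod_eq_zero (Finset.mem_univ j), mul_zero]
    exact Finset.prod_eq_zero (Finset.mem_univ i) (if_neg (Ne.symm hj))
  · simp

theorem hasSum_weight_mul_pow [∀ j, Nonempty (n j)] {t s : ℕ} (hM : ∀ j, IsDesign t (M j))
    (hs : s ≤ t) (Δ : Matrix (∀ j, n j) (∀ j, n j) ℂ) :
    HasSum (fun x : ∀ j, X j => (∏ j, (M j (x j)).trace / (Fintype.card (n j) : ℂ)) *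
      (Δ * tensorProd fun j => (M j (x j)).trace⁻¹ • M j (x j)).trace ^ s)
      ((∏ j, ((Fintype.card (n j)).ascFactorial s : ℂ)⁻¹) *
        ∑ σ : Fin K → Equiv.Perm (Fin s), permContraction Δ σ) := by
  have h1 : ∀ x : ∀ j, X j, (∏ j, (M j (x j)).trace / (Fintype.card (n j) : ℂ)) *
      (Δ * tensorProd fun j => (M j (x j)).trace⁻¹ • M j (x j)).trace ^ s
      = ∑ q : Fin s → (∀ j, n j) × (∀ j, n j), (∏ i, Δ (q i).1 (q i).2) *
          ∏ j, ((M j (x j)).trace / (Fintype.card (n j) : ℂ) *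
            ∏ i, ((M j (x j)).trace⁻¹ • M j (x j)) ((q i).2 j) ((q i).1 j)) := by
    intro x
    have : (Δ * tensorProd fun j => (M j (x j)).trace⁻¹ • M j (x j)).trace
        = ∑ p : (∀ j, n j) × (∀ j, n j), Δ p.1 p.2 *
          ∏ j, ((M j (x j)).trace⁻¹ • M j (x j)) (p.2 j) (p.1 j) := by
      simp only [Matrix.trace, Matrix.diag, Matrix.mul_apply, Fintype.sum_prod_type, tensorProd,
        Matrix.of_apply]
    rw [this, Fintype.sum_pow, Finset.mul_sum]
    refine Finset.sum_congr rfl fun q _ => ?_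
    rw [Finset.prod_mul_distrib, Finset.prod_mul_distrib,
      Finset.prod_comm (f := fun i j => ((M j (x j)).trace⁻¹ • M j (x j)) ((q i).2 j) ((q i).1 j))]
    ring
  simp only [h1]
  have h2 : (∏ j, ((Fintype.card (n j)).ascFactorial s : ℂ)⁻¹) *
        ∑ σ : Fin K → Equiv.Perm (Fin s), permContraction Δ σ
      = ∑ q : Fin s → (∀ j, n j) × (∀ j, n j), (∏ i, Δ (q i).1 (q i).2) *
          ∏ j, uniformMoment (n j) s (fun i => (q i).2 j) (fun i => (q i).1 j) := by
    simp only [← sum_prod_mul_prod_ite, uniformMoment_apply, Finset.prod_mul_distrib]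
    rw [Finset.sum_comm, Finset.mul_sum]
    refine Finset.sum_congr rfl fun q _ => ?_
    rw [Finset.prod_univ_sum, Fintype.piFinset_univ, ← Finset.mul_sum]
    ring
  rw [h2]
  refine hasSum_sum fun q _ => HasSum.mul_left _ ?_
  exact hasSum_pi_prod (fun j y => (M j y).trace / (Fintype.card (n j) : ℂ) *
            ∏ i, ((M j y).trace⁻¹ • M j y) ((q i).2 j) ((q i).1 j)) _
    fun j => (hM j).hasSum_weight_mul_prod hs _ _

end

/-! ### Averages over product spaces and iterated Cauchy–Schwarz. -/

section Average

variable {ι : Type*} [Fintype ι] [DecidableEq ι] {V : ι → Type*} [∀ e, Fintype (V e)]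

/-- Exchanging the `S`-coordinates of `v` and `w` is an involution on pairs. -/
theorem expect_expect_piecewise [∀ e, Nonempty (V e)] {R : Type*} [AddCommMonoid R] [Module ℚ≥0 R]
    (S : Finset ι) (g : (∀ e, V e) → R) :
    𝔼 v : ∀ e, V e, 𝔼 w : ∀ e, V e, g (S.piecewise w v) = 𝔼 v, g v := by
  have hinv : Function.Involutive fun p : (∀ e, V e) × (∀ e, V e) =>
      (S.piecewise p.2 p.1, S.piecewise p.1 p.2) := by
    rintro ⟨v, w⟩
    ext e <;> by_cases he : e ∈ S <;> simp [he]
  rw [← Finset.expect_product' Finset.univ Finset.univ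
    (fun v w : ∀ e, V e => g (S.piecewise w v)), Finset.univ_product_univ,
    Fintype.expect_equiv hinv.toPerm (fun p => g (S.piecewise p.2 p.1)) (fun p => g p.1)
      (fun _ => rfl), ← Finset.univ_product_univ, Finset.expect_product]
  simp

omit [Fintype ι] [∀ e, Fintype (V e)] in
theorem dependsOn_comp_piecewise {β : Type*} {g : (∀ e, V e) → β} {s : Set ι}
    (hg : DependsOn g s) (S : Finset ι) (w : ∀ e, V e) :
    DependsOn (fun v => g (S.piecewise w v)) (s \ S) := by
  intro x y hxy
  refine hg fun e he => ?_
  by_cases h : e ∈ S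
  · simp [h]
  · simpa [h] using hxy e ⟨he, h⟩

theorem dependsOn_expect_piecewise {R : Type*} [AddCommMonoid R] [Module ℚ≥0 R]
    {g : (∀ e, V e) → R} {s : Set ι} (hg : DependsOn g s) (S : Finset ι) :
    DependsOn (fun v => 𝔼 w : ∀ e, V e, g (S.piecewise w v)) (s \ S) := by
  intro x y hxy
  exact Finset.expect_congr rfl fun w _ => dependsOn_comp_piecewise hg S w hxy

omit [Fintype ι] [∀ e, Fintype (V e)] in
theorem apply_piecewise_of_dependsOn {β : Type*} {g : (∀ e, V e) → β} {s : Set ι}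
    (hg : DependsOn g s) {S : Finset ι} (hS : Disjoint s S) (w v : ∀ e, V e) :
    g (S.piecewise w v) = g v :=
  hg fun e he => by simp [show e ∉ S from fun h => Set.disjoint_left.mp hS he h]

/-- Factors may be averaged separately over sets of coordinates on which no other factor
depends. -/
theorem expect_prod_eq_expect_prod_expect [∀ e, Nonempty (V e)] {κ : Type*} [Fintype κ]
    [DecidableEq κ] {R : Type*} [CommSemiring R] [Module ℚ≥0 R] [IsScalarTower ℚ≥0 R R]
    [SMulCommClass ℚ≥0 R R] (g : κ → (∀ e, V e) → R) (s : κ → Set ι) (S : κ → Finset ι)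
    (hg : ∀ i, DependsOn (g i) (s i)) (hS : ∀ i k, i ≠ k → Disjoint (s i) (S k)) :
    𝔼 v, ∏ i, g i v = 𝔼 v : ∀ e, V e, ∏ i, 𝔼 w : ∀ e, V e, g i ((S i).piecewise w v) := by
  suffices h : ∀ T : Finset κ, 𝔼 v, ∏ i, g i v = 𝔼 v : ∀ e, V e,
      ∏ i, if i ∈ T then 𝔼 w : ∀ e, V e, g i ((S i).piecewise w v) else g i v by
    simpa using h Finset.univ
  -- Factors are averaged one by one: resampling the coordinates in `S k` affects only factor `k`.
  intro T
  induction T using Finset.induction_on with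
  | empty => simp
  | insert k T hk ih =>
    rw [ih, ← expect_expect_piecewise (S k)]
    refine Finset.expect_congr rfl fun v _ => ?_
    rw [← Finset.mul_prod_erase _ _ (Finset.mem_univ k), if_pos (Finset.mem_insert_self k T),
      Finset.expect_mul]
    refine Finset.expect_congr rfl fun w _ => ?_
    rw [← Finset.mul_prod_erase _ _ (Finset.mem_univ k), if_neg hk]
    congr 1
    refine Finset.prod_congr rfl fun i hi => ?_
    have hik : i ≠ k := (Finset.mem_erase.mp hi).1
    simp only [Finset.mem_insert, hik, false_or]
    split_ifs
    · exact apply_piecewise_of_dependsOn (dependsOn_expect_piecewise (hg i) (S i))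
        ((hS i k hik).mono_left Set.sdiff_subset) w v
    · exact apply_piecewise_of_dependsOn (hg i) (hS i k hik) w v

/-- Cauchy–Schwarz on the factors `p` and `q`; a nonnegative constant is its own $L^2$ norm. -/
theorem expect_prod_le_of_two_nonconstant {W κ : Type*} [Fintype W] [Nonempty W] [Fintype κ]
    [DecidableEq κ] (G : κ → W → ℝ) (c : κ → ℝ) (hG : ∀ i w, 0 ≤ G i w) {p q : κ} (hpq : p ≠ q)
    (hc : ∀ i, i ≠ p → i ≠ q → ∀ w, G i w = c i) :
    𝔼 w, ∏ i, G i w ≤ ∏ i, √(𝔼 w, G i w ^ 2) := by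
  have hq : q ∈ Finset.univ.erase p := by simp [hpq.symm]
  have hsplit : ∀ f : κ → ℝ, ∏ i, f i = f p * f q * ∏ i ∈ (Finset.univ.erase p).erase q, f i := by
    intro f
    rw [← Finset.mul_prod_erase _ _ (Finset.mem_univ p), ← Finset.mul_prod_erase _ _ hq, mul_assoc]
  have hrest : ∀ w, ∏ i ∈ (Finset.univ.erase p).erase q, G i w
      = ∏ i ∈ (Finset.univ.erase p).erase q, √(𝔼 w, G i w ^ 2) := by
    intro w
    refine Finset.prod_congr rfl fun i hi => ?_
    simp only [Finset.mem_erase, Finset.mem_univ, and_true] at hi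
    have h := hc i hi.2 hi.1
    simp only [h, Fintype.expect_const]
    rw [Real.sqrt_sq (h w ▸ hG i w)]
  simp only [hsplit, hrest]
  rw [← Finset.expect_mul]
  refine mul_le_mul_of_nonneg_right ?_ (Finset.prod_nonneg fun _ _ => Real.sqrt_nonneg _)
  rw [← Real.sqrt_mul (Finset.expect_nonneg fun _ _ => sq_nonneg _)]
  exact Real.le_sqrt_of_sq_le (Finset.expect_mul_sq_le_sq_mul_sq _ _ _)

/-- If each coordinate occurs in at most two factors, the average of the product is at most the
product of the `L²` norms. -/
theorem expect_prod_le_prod_sqrt [∀ e, Nonempty (V e)] {κ : Type*} [Fintype κ] [DecidableEq κ]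
    (F : κ → (∀ e, V e) → ℝ) (hF : ∀ i v, 0 ≤ F i v) (s : κ → Set ι)
    (hdep : ∀ i, DependsOn (F i) (s i))
    (h2 : ∀ e, ∃ p q, p ≠ q ∧ ∀ i, e ∈ s i → i = p ∨ i = q) :
    𝔼 v, ∏ i, F i v ≤ ∏ i, √(𝔼 v, F i v ^ 2) := by
  suffices h : ∀ (S : Finset ι) (F : κ → (∀ e, V e) → ℝ) (s : κ → Set ι), (∀ i v, 0 ≤ F i v) →
      (∀ i, DependsOn (F i) (s i)) → (∀ e, ∃ p q, p ≠ q ∧ ∀ i, e ∈ s i → i = p ∨ i = q) →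
      (∀ i, s i ⊆ S) → 𝔼 v, ∏ i, F i v ≤ ∏ i, √(𝔼 v, F i v ^ 2) from
    h Finset.univ F s hF hdep h2 fun i => by simp
  clear! F s
  intro S
  induction S using Finset.induction_on with
  | empty =>
    intro F s hF hdep _ hs
    obtain ⟨v₀⟩ : Nonempty (∀ e, V e) := inferInstance
    have h : ∀ i v, F i v = F i v₀ := fun i v => hdep i fun e he => by simpa using hs i he
    simp only [h, Fintype.expect_const]
    exact Finset.prod_le_prod (fun i _ => hF i v₀) fun i _ => by rw [Real.sqrt_sq (hF i v₀)]
  | insert e S he ih =>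
    intro F s hF hdep h2 hs
    -- Taking the $L^2$ norm in the coordinate `e` alone keeps the full $L^2$ norm and eliminates
    -- the dependence on `e`.
    let F' : κ → (∀ e, V e) → ℝ := fun i v =>
      √(𝔼 w : ∀ e, V e, F i (Finset.piecewise {e} w v) ^ 2)
    have hdep' : ∀ i, DependsOn (F' i) (s i \ {e}) := by
      intro i x y hxy
      have h : DependsOn (fun v => F i v ^ 2) (s i) := fun x y hxy => by
        simp only [hdep i hxy]
      exact congrArg Real.sqrt (dependsOn_expect_piecewise h {e} (by simpa using hxy))
    have hsq : ∀ i, 𝔼 v, F' i v ^ 2 = 𝔼 v, F i v ^ 2 := by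
      intro i
      rw [← expect_expect_piecewise {e} (fun v => F i v ^ 2)]
      refine Finset.expect_congr rfl fun v _ => ?_
      exact Real.sq_sqrt (Finset.expect_nonneg fun _ _ => sq_nonneg _)
    have h := ih F' (fun i => s i \ {e}) (fun i v => Real.sqrt_nonneg _) hdep'
      (fun e' => by
        obtain ⟨p, q, hpq, h⟩ := h2 e'
        exact ⟨p, q, hpq, fun i hi => h i hi.1⟩)
      (fun i x hx => by simpa [show x ≠ e from hx.2] using hs i hx.1)
    simp only [hsq] at h
    refine le_trans ?_ h
    rw [← expect_expect_piecewise {e}]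
    refine Finset.expect_le_expect fun v _ => ?_
    obtain ⟨p, q, hpq, h⟩ := h2 e
    refine expect_prod_le_of_two_nonconstant (fun i w => F i (Finset.piecewise {e} w v))
      (fun i => F i v) (fun i w => hF i _) hpq fun i hip hiq w => ?_
    refine apply_piecewise_of_dependsOn (hdep i) ?_ w v
    have : e ∉ s i := fun hi => (h i hi).elim hip hiq
    simpa using this

end Average

theorem expect_apply_eq {κ Y R : Type*} [Fintype κ] [DecidableEq κ] [Fintype Y] [Nonempty Y]
    [AddCommMonoid R] [Module ℚ≥0 R] (i : κ) (G : Y → R) :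
    𝔼 a : κ → Y, G (a i) = 𝔼 y, G y := by
  rw [Fintype.expect_equiv (Equiv.funSplitAt i Y) (fun a => G (a i)) (fun p => G p.1)
    (fun _ => rfl), ← Finset.univ_product_univ, Finset.expect_product]
  simp

theorem expect_apply_apply_eq {κ Y R : Type*} [Fintype κ] [DecidableEq κ] [Fintype Y] [Nonempty Y]
    [AddCommMonoid R] [Module ℚ≥0 R] {i k : κ} (hik : k ≠ i) (H : Y → Y → R) :
    𝔼 a : κ → Y, H (a k) (a i) = 𝔼 r, 𝔼 c, H r c := by
  rw [Fintype.expect_equiv (Equiv.funSplitAt i Y) (fun a => H (a k) (a i))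
    (fun p => H (p.2 ⟨k, hik⟩) p.1) (fun _ => rfl), ← Finset.univ_product_univ,
    Finset.expect_product, Finset.expect_comm (f := fun r c => H r c)]
  refine Finset.expect_congr rfl fun c _ => ?_
  exact expect_apply_eq (⟨k, hik⟩ : {j // j ≠ i}) (fun r => H r c)

/-- `tr |tr_I Δ|²`. -/
noncomputable def partialTraceSq {ι : Type*} [Fintype ι] [DecidableEq ι] {n : ι → Type*}
    [∀ j, Fintype (n j)]
    (Δ : Matrix (∀ j, n j) (∀ j, n j) ℂ) (I : Finset ι) : ℝ :=
  ((partialTrace I Δ).conjTranspose * partialTrace I Δ).trace.re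

/-! ### Partial traces as averages. -/

section PartialTrace

variable {ι : Type*} [Fintype ι] [DecidableEq ι] {n : ι → Type*} [∀ j, Fintype (n j)]

theorem partialTraceSq_eq_sum (Δ : Matrix (∀ j, n j) (∀ j, n j) ℂ) (I : Finset ι) :
    partialTraceSq Δ I = ∑ c, ∑ r, ‖partialTrace I Δ r c‖ ^ 2 := by
  simp only [partialTraceSq, Matrix.trace, Matrix.diag, Matrix.mul_apply,
    Matrix.conjTranspose_apply, RCLike.star_def, Complex.conj_mul', Complex.re_sum]
  refine Finset.sum_congr rfl fun c _ => Finset.sum_congr rfl fun r _ => ?_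
  norm_cast

theorem partialTraceSq_nonneg (Δ : Matrix (∀ j, n j) (∀ j, n j) ℂ) (I : Finset ι) :
    0 ≤ partialTraceSq Δ I := by
  rw [partialTraceSq_eq_sum]
  positivity

omit [Fintype ι] [∀ j, Fintype (n j)] in
theorem piecewise_piEquivPiSubtypeProd_symm (I : Finset ι)
    (z r : (∀ j : {j // j ∈ I}, n j) × (∀ j : {j // ¬ j ∈ I}, n j)) :
    I.piecewise ((Equiv.piEquivPiSubtypeProd (fun j => j ∈ I) n).symm z)
      ((Equiv.piEquivPiSubtypeProd (fun j => j ∈ I) n).symm r)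
      = (Equiv.piEquivPiSubtypeProd (fun j => j ∈ I) n).symm (z.1, r.2) := by
  ext j
  by_cases h : j ∈ I <;> simp [Equiv.piEquivPiSubtypeProd, h]

theorem expect_eq_expect_piEquivPiSubtypeProd {R : Type*} [AddCommMonoid R] [Module ℚ≥0 R]
    (I : Finset ι) (G : (∀ j, n j) → R) :
    𝔼 v, G v = 𝔼 x, 𝔼 y, G ((Equiv.piEquivPiSubtypeProd (fun j => j ∈ I) n).symm (x, y)) := by
  rw [Fintype.expect_equiv (Equiv.piEquivPiSubtypeProd (fun j => j ∈ I) n) G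
    (fun p => G ((Equiv.piEquivPiSubtypeProd (fun j => j ∈ I) n).symm p)) (fun _ => by rw [Equiv.symm_apply_apply]),
    ← Finset.univ_product_univ, Finset.expect_product]

/-- Idle coordinates do not affect averages. The inner average contributes $D_I^{-1}$, squared by
the norm, and the outer ones $D_{I^c}^{-2}$, which together make $D^{-2}$. -/
theorem expect_norm_expect_sq [∀ j, Nonempty (n j)] (Δ : Matrix (∀ j, n j) (∀ j, n j) ℂ)
    (I : Finset ι) :
    𝔼 r : ∀ j, n j, 𝔼 c : ∀ j, n j,
      ‖𝔼 z : ∀ j, n j, Δ (I.piecewise z r) (I.piecewise z c)‖ ^ 2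
      = partialTraceSq Δ I / (Fintype.card (∀ j, n j) : ℝ) ^ 2 := by
  have hcard : Fintype.card (∀ j, n j) = Fintype.card (∀ j : {j // j ∈ I}, n j)
      * Fintype.card (∀ j : {j // ¬ j ∈ I}, n j) := by
    rw [← Fintype.card_prod]
    exact Fintype.card_congr (Equiv.piEquivPiSubtypeProd (fun j => j ∈ I) n)
  have h1 : ∀ r c, 𝔼 z : ∀ j, n j, Δ (I.piecewise z ((Equiv.piEquivPiSubtypeProd (fun j => j ∈ I) n).symm r))
        (I.piecewise z ((Equiv.piEquivPiSubtypeProd (fun j => j ∈ I) n).symm c))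
      = partialTrace I Δ r.2 c.2 / (Fintype.card (∀ j : {j // j ∈ I}, n j) : ℂ) := by
    intro r c
    rw [expect_eq_expect_piEquivPiSubtypeProd I]
    simp only [piecewise_piEquivPiSubtypeProd_symm, Fintype.expect_const]
    rw [Fintype.expect_eq_sum_div_card]
    rfl
  have h2 : 𝔼 r : ∀ j, n j, 𝔼 c : ∀ j, n j,
      ‖𝔼 z : ∀ j, n j, Δ (I.piecewise z r) (I.piecewise z c)‖ ^ 2
      = 𝔼 r, 𝔼 c, ‖partialTrace I Δ r c / (Fintype.card (∀ j : {j // j ∈ I}, n j) : ℂ)‖ ^ 2 := by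
    have h : ∀ r, 𝔼 c : ∀ j, n j, ‖𝔼 z : ∀ j, n j,
        Δ (I.piecewise z ((Equiv.piEquivPiSubtypeProd (fun j => j ∈ I) n).symm r))
          (I.piecewise z c)‖ ^ 2
        = 𝔼 c, ‖partialTrace I Δ r.2 c / (Fintype.card (∀ j : {j // j ∈ I}, n j) : ℂ)‖ ^ 2 := by
      intro r
      rw [expect_eq_expect_piEquivPiSubtypeProd I]
      simp only [h1, Fintype.expect_const]
    rw [expect_eq_expect_piEquivPiSubtypeProd I]
    simp only [h, Fintype.expect_const]
  rw [h2, partialTraceSq_eq_sum, hcard, Finset.sum_comm]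
  simp only [Fintype.expect_eq_sum_div_card, norm_div, Complex.norm_natCast, div_pow,
    ← Finset.sum_div, Nat.cast_mul]
  have h3 : (Fintype.card (∀ j : {j // j ∈ I}, n j) : ℝ) ≠ 0 := by
    exact_mod_cast Fintype.card_ne_zero
  have h4 : (Fintype.card (∀ j : {j // ¬ j ∈ I}, n j) : ℝ) ≠ 0 := by
    exact_mod_cast Fintype.card_ne_zero
  field_simp

end PartialTrace

/-! ### Bounding a contraction by partial traces. -/

section Contraction

variable {ι : Type*} [Fintype ι] [DecidableEq ι] {n : ι → Type*} [∀ j, Fintype (n j)]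
  {κ : Type*} [Fintype κ] [DecidableEq κ]

/-- The tensor factors whose permutation fixes the copy `i`. -/
def fixedFactors (σ : ι → Equiv.Perm κ) (i : κ) : Finset ι :=
  Finset.univ.filter fun j => σ j i = i

/-- Outside the fixed factors, the row of copy `i` is read from copies other than `i` that vary with
the factor. Relabelling copies factor by factor moves them all to one copy `k`, making row and
column independent. -/
theorem expect_norm_sq_loops [∀ j, Nonempty (n j)] [Nontrivial κ]
    (Δ : Matrix (∀ j, n j) (∀ j, n j) ℂ) (σ : ι → Equiv.Perm κ) (i : κ) :
    𝔼 a : κ → ∀ j, n j, ‖𝔼 z : ∀ j, n j,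
        Δ ((fixedFactors σ i).piecewise z (fun j => a (σ j i) j))
          ((fixedFactors σ i).piecewise z (a i))‖ ^ 2
      = partialTraceSq Δ (fixedFactors σ i) / (Fintype.card (∀ j, n j) : ℝ) ^ 2 := by
  set I := fixedFactors σ i with hI
  obtain ⟨k, hk⟩ := exists_ne i
  let m : ι → κ := fun j => if σ j i = i then k else σ j i
  have hm : ∀ j, m j ≠ i := fun j => by
    simp only [m]
    split_ifs with h
    · exact hk
    · exact h
  let ρ : ι → Equiv.Perm κ := fun j => Equiv.swap k (m j)
  let e : (κ → ∀ j, n j) ≃ (κ → ∀ j, n j) :=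
    ⟨fun a l j => a (ρ j l) j, fun a l j => a (ρ j l) j,
      fun a => by ext l j; simp [ρ], fun a => by ext l j; simp [ρ]⟩
  rw [← expect_norm_expect_sq, ← expect_apply_apply_eq hk (fun r c =>
    ‖𝔼 z : ∀ j, n j, Δ (I.piecewise z r) (I.piecewise z c)‖ ^ 2)]
  refine Fintype.expect_equiv e _ _ fun a => ?_
  have h1 : e a i = a i := by
    ext j
    simp only [e, ρ, Equiv.coe_fn_mk]
    rw [Equiv.swap_apply_of_ne_of_ne hk.symm (hm j).symm]
  have h2 : ∀ z, I.piecewise z (fun j => a (σ j i) j) = I.piecewise z (e a k) := by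
    intro z
    refine Finset.piecewise_congr _ (fun _ _ => rfl) fun j hj => ?_
    have hj' : ¬ σ j i = i := by simpa [hI, fixedFactors] using hj
    simp only [e, ρ, m, Equiv.coe_fn_mk, if_neg hj', Equiv.swap_apply_left]
  simp only [h1, h2]

/-- View the contraction as a graph on the copies. Fixed points are loops and sum to partial traces;
every other index joins two distinct copies, so Cauchy–Schwarz applies index by index. -/
theorem norm_permContraction_le [∀ j, Nonempty (n j)] [Nontrivial κ]
    (Δ : Matrix (∀ j, n j) (∀ j, n j) ℂ) (σ : ι → Equiv.Perm κ) :
    ‖permContraction Δ σ‖ ≤ ∏ i, √(partialTraceSq Δ (fixedFactors σ i)) := by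
  let u : (κ → ∀ j, n j) ≃ (∀ e : κ × ι, n e.2) :=
    ⟨fun a e => a e.1 e.2, fun v i j => v (i, j), fun _ => rfl, fun _ => rfl⟩
  let g : κ → (∀ e : κ × ι, n e.2) → ℂ := fun i v => Δ (fun j => v (σ j i, j)) (fun j => v (i, j))
  -- The loops at copy `i`: index variables occurring in no other copy.
  let S : κ → Finset (κ × ι) := fun i => Finset.univ.filter fun e => e.1 = i ∧ σ e.2 i = i
  let s : κ → Set (κ × ι) := fun i => {e | e.1 = i ∨ e.1 = σ e.2 i}
  have hg : ∀ i, DependsOn (g i) (s i) := by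
    intro i x y hxy
    have h1 : (fun j => x (σ j i, j)) = fun j => y (σ j i, j) :=
      funext fun j => hxy (σ j i, j) (Or.inr rfl)
    have h2 : (fun j => x (i, j)) = fun j => y (i, j) := funext fun j => hxy (i, j) (Or.inl rfl)
    simp only [g, h1, h2]
  have hS : ∀ i k, i ≠ k → Disjoint (s i) (S k) := by
    intro i k hik
    rw [Set.disjoint_left]
    rintro ⟨l, j⟩ hl hS
    simp only [S, Finset.coe_filter, Finset.mem_univ, true_and, Set.mem_ofPred_eq] at hS
    obtain ⟨rfl, hj⟩ := hS
    rcases hl with h | h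
    · exact hik h.symm
    · exact hik ((σ j).injective (h.symm.trans hj.symm))
  let A : κ → (∀ e : κ × ι, n e.2) → ℂ := fun i v =>
    𝔼 w : ∀ e : κ × ι, n e.2, g i ((S i).piecewise w v)
  have hA : ∀ i a, A i (u a) = 𝔼 z : ∀ j, n j,
        Δ ((fixedFactors σ i).piecewise z (fun j => a (σ j i) j))
          ((fixedFactors σ i).piecewise z (a i)) := by
    intro i a
    rw [← expect_apply_eq (κ := κ) i]
    symm
    refine Fintype.expect_equiv u _ _ fun b => ?_
    simp only [g]
    congr 1
    · ext j
      by_cases h : σ j i = i <;> simp [fixedFactors, S, h, u, Finset.piecewise]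
    · ext j
      by_cases h : σ j i = i <;> simp [fixedFactors, S, h, u, Finset.piecewise]
  have hnorm : ∀ i, 𝔼 v, ‖A i v‖ ^ 2
      = partialTraceSq Δ (fixedFactors σ i) / (Fintype.card (∀ j, n j) : ℝ) ^ 2 := by
    intro i
    rw [← expect_norm_sq_loops]
    symm
    exact Fintype.expect_equiv u _ _ fun a => by rw [hA]
  have hle : ‖𝔼 v, ∏ i, g i v‖ ≤ ∏ i, √(𝔼 v, ‖A i v‖ ^ 2) := by
    rw [expect_prod_eq_expect_prod_expect g s S hg hS]
    refine RCLike.norm_expect_le (K := ℝ).trans ?_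
    simp only [norm_prod]
    refine expect_prod_le_prod_sqrt (fun i v => ‖A i v‖) (fun _ _ => norm_nonneg _)
      (fun i => s i \ S i) (fun i x y hxy => ?_) ?_
    · exact congrArg norm (dependsOn_expect_piecewise (hg i) (S i) hxy)
    · rintro ⟨k, j⟩
      by_cases h : (σ j).symm k = k
      · obtain ⟨l, hl⟩ := exists_ne k
        refine ⟨k, l, hl.symm, fun i hi => Or.inl ?_⟩
        rcases hi.1 with h' | h'
        · exact h'.symm
        · rw [← h, show k = σ j i from h', Equiv.symm_apply_apply]
      · refine ⟨k, (σ j).symm k, fun h' => h h'.symm, fun i hi => ?_⟩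
        rcases hi.1 with h' | h'
        · exact Or.inl h'.symm
        · exact Or.inr (by rw [show k = σ j i from h', Equiv.symm_apply_apply])
  have hD : (Fintype.card (∀ j, n j) : ℝ) ≠ 0 := by exact_mod_cast Fintype.card_ne_zero
  have hsum : permContraction Δ σ
      = (Fintype.card (∀ j, n j) : ℂ) ^ Fintype.card κ * 𝔼 v, ∏ i, g i v := by
    have : (Fintype.card (κ → ∀ j, n j) : ℂ)
        = (Fintype.card (∀ j, n j) : ℂ) ^ Fintype.card κ := by simp
    rw [← this, ← Fintype.expect_equiv u (fun a => ∏ i, g i (u a)) _ fun _ => rfl,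
      Fintype.card_mul_expect]
    rfl
  rw [hsum, norm_mul, norm_pow, Complex.norm_natCast]
  refine (mul_le_mul_of_nonneg_left hle (by positivity)).trans (le_of_eq ?_)
  simp only [hnorm]
  -- Turning the sum into an average costs $D$ per copy, cancelling the $1/D$ in each $L^2$ norm.
  have hpow : (Fintype.card (∀ j, n j) : ℝ) ^ Fintype.card κ
      = ∏ _i : κ, (Fintype.card (∀ j, n j) : ℝ) := by rw [Finset.prod_const, Finset.card_univ]
  rw [hpow, ← Finset.prod_mul_distrib]
  refine Finset.prod_congr rfl fun i _ => ?_
  rw [Real.sqrt_div (partialTraceSq_nonneg _ _), Real.sqrt_sq (by positivity),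
    mul_div_cancel₀ _ hD]

end Contraction

/-! ### Second and fourth permutation sums. -/

section Moments

variable {ι : Type*} [Fintype ι] [DecidableEq ι] {n : ι → Type*} [∀ j, Fintype (n j)]

theorem multiNorm_sq (Δ : Matrix (∀ j, n j) (∀ j, n j) ℂ) :
    multiNorm Δ ^ 2 = ∑ I : Finset ι, partialTraceSq Δ I :=
  Real.sq_sqrt (Finset.sum_nonneg fun I _ => partialTraceSq_nonneg Δ I)

theorem multiNorm_nonneg (Δ : Matrix (∀ j, n j) (∀ j, n j) ℂ) : 0 ≤ multiNorm Δ :=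
  Real.sqrt_nonneg _

/-- Identities trace out `I` and swaps multiply the two copies, giving
$\operatorname{tr}(\operatorname{tr}_I\Delta)^2$; hermiticity turns the square into $|\cdot|^2$. -/
theorem permContraction_swap_eq_partialTraceSq {Δ : Matrix (∀ j, n j) (∀ j, n j) ℂ}
    (hΔ : Δ.IsHermitian) (I : Finset ι) :
    permContraction Δ (fun j => if j ∈ I then 1 else Equiv.swap (0 : Fin 2) 1)
      = partialTraceSq Δ I := by
  have h1 : permContraction Δ (fun j => if j ∈ I then 1 else Equiv.swap (0 : Fin 2) 1)
      = ∑ x : ∀ j, n j, ∑ y : ∀ j, n j,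
        Δ (I.piecewise x y) x * Δ (I.piecewise y x) y := by
    rw [permContraction, ← (finTwoArrowEquiv (∀ j, n j)).symm.sum_comp, Fintype.sum_prod_type]
    refine Finset.sum_congr rfl fun x _ => Finset.sum_congr rfl fun y _ => ?_
    rw [Fin.prod_univ_two]
    congr 2
    · ext j
      by_cases h : j ∈ I <;> simp [h]
    · ext j
      by_cases h : j ∈ I <;> simp [h]
  have h2 : ∀ r c, star (partialTrace I Δ r c) = partialTrace I Δ c r := by
    intro r c
    simp only [partialTrace, Matrix.of_apply, star_sum]
    exact Finset.sum_congr rfl fun z _ => hΔ.apply _ _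
  rw [h1, partialTraceSq_eq_sum]
  push_cast
  simp only [← Complex.conj_mul', ← RCLike.star_def, h2]
  rw [← (Equiv.piEquivPiSubtypeProd (fun j => j ∈ I) n).symm.sum_comp, Fintype.sum_prod_type,
    Finset.sum_comm]
  refine Finset.sum_congr rfl fun c _ => ?_
  have h3 : ∀ x, ∑ y, Δ (I.piecewise ((Equiv.piEquivPiSubtypeProd (fun j => j ∈ I) n).symm x) y)
        ((Equiv.piEquivPiSubtypeProd (fun j => j ∈ I) n).symm x) *
        Δ (I.piecewise y ((Equiv.piEquivPiSubtypeProd (fun j => j ∈ I) n).symm x)) y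
      = ∑ r, Δ ((Equiv.piEquivPiSubtypeProd (fun j => j ∈ I) n).symm (x.1, r))
        ((Equiv.piEquivPiSubtypeProd (fun j => j ∈ I) n).symm x) * partialTrace I Δ x.2 r := by
    intro x
    rw [← (Equiv.piEquivPiSubtypeProd (fun j => j ∈ I) n).symm.sum_comp, Fintype.sum_prod_type,
      Finset.sum_comm]
    refine Finset.sum_congr rfl fun r _ => ?_
    simp only [piecewise_piEquivPiSubtypeProd_symm]
    rw [← Finset.mul_sum]
    rfl
  simp only [h3]
  rw [Finset.sum_comm]
  refine Finset.sum_congr rfl fun r _ => ?_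
  rw [← Finset.sum_mul, mul_comm]
  rfl

/-- A permutation of two copies is determined by whether it fixes `0`, so tuples correspond to
subsets of factors. -/
theorem sum_permContraction_two {Δ : Matrix (∀ j, n j) (∀ j, n j) ℂ} (hΔ : Δ.IsHermitian) :
    ∑ σ : ι → Equiv.Perm (Fin 2), permContraction Δ σ = ((multiNorm Δ ^ 2 : ℝ) : ℂ) := by
  have hperm : ∀ p : Equiv.Perm (Fin 2), (if p 0 = 0 then 1 else Equiv.swap 0 1) = p := by decide
  rw [multiNorm_sq]
  push_cast
  refine Fintype.sum_equiv
    ⟨fun σ => fixedFactors σ 0, fun I j => if j ∈ I then 1 else Equiv.swap 0 1, fun σ => ?_,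
      fun I => ?_⟩ _ _ fun σ => ?_
  · ext1 j
    simp only [fixedFactors, Finset.mem_filter, Finset.mem_univ, true_and]
    exact hperm (σ j)
  · ext j
    by_cases h : j ∈ I <;> simp [fixedFactors, h]
  · rw [← permContraction_swap_eq_partialTraceSq hΔ]
    congr 1
    ext1 j
    simp only [fixedFactors, Finset.mem_filter, Finset.mem_univ, true_and, Equiv.coe_fn_mk]
    exact (hperm (σ j)).symm

theorem card_fixedFactors_fiber_le {κ : Type*} [Fintype κ] [DecidableEq κ] {i k : κ} {C : ℕ}
    (hC : ∀ b c : Bool, (Finset.univ.filter fun p : Equiv.Perm κ =>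
      decide (p i = i) = b ∧ decide (p k = k) = c).card ≤ C) (I J : Finset ι) :
    (Finset.univ.filter fun σ : ι → Equiv.Perm κ =>
      (fixedFactors σ i, fixedFactors σ k) = (I, J)).card ≤ C ^ Fintype.card ι := by
  have h : (Finset.univ.filter fun σ : ι → Equiv.Perm κ =>
      (fixedFactors σ i, fixedFactors σ k) = (I, J))
      = Fintype.piFinset fun j => Finset.univ.filter fun p : Equiv.Perm κ =>
        decide (p i = i) = decide (j ∈ I) ∧ decide (p k = k) = decide (j ∈ J) := by
    ext σ
    simp [Finset.ext_iff, fixedFactors, forall_and]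
  rw [h, Fintype.card_piFinset, ← Finset.card_univ]
  exact Finset.prod_le_pow_card _ _ _ fun j _ => hC _ _

/-- The summand depends only on the pair of fixed sets, and prescribing that pair constrains each
tensor factor separately. -/
theorem sum_mul_fixedFactors_le {κ : Type*} [Fintype κ] [DecidableEq κ] {i k : κ} {C : ℕ}
    (hC : ∀ b c : Bool, (Finset.univ.filter fun p : Equiv.Perm κ =>
      decide (p i = i) = b ∧ decide (p k = k) = c).card ≤ C)
    (q : Finset ι → ℝ) (hq : ∀ I, 0 ≤ q I) :
    ∑ σ : ι → Equiv.Perm κ, q (fixedFactors σ i) * q (fixedFactors σ k)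
      ≤ C ^ Fintype.card ι * (∑ I, q I) ^ 2 := by
  rw [← Finset.sum_fiberwise' Finset.univ
    (fun σ : ι → Equiv.Perm κ => (fixedFactors σ i, fixedFactors σ k)) (fun p => q p.1 * q p.2),
    Fintype.sum_prod_type, sq, Finset.sum_mul_sum, Finset.mul_sum]
  refine Finset.sum_le_sum fun I _ => ?_
  rw [Finset.mul_sum]
  refine Finset.sum_le_sum fun J _ => ?_
  rw [Finset.sum_const, nsmul_eq_mul]
  refine mul_le_mul_of_nonneg_right ?_ (mul_nonneg (hq I) (hq J))
  exact_mod_cast card_fixedFactors_fiber_le hC I J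

/-- The counts are 14 with neither point fixed, 4 for each single one, and 2 with both. -/
theorem card_perm_four_fixed_le_left (b c : Bool) :
    (Finset.univ.filter fun p : Equiv.Perm (Fin 4) =>
      decide (p 0 = 0) = b ∧ decide (p 1 = 1) = c).card ≤ 18 := by
  revert b c
  decide +kernel

theorem card_perm_four_fixed_le_right (b c : Bool) :
    (Finset.univ.filter fun p : Equiv.Perm (Fin 4) =>
      decide (p 2 = 2) = b ∧ decide (p 3 = 3) = c).card ≤ 18 := by
  revert b c
  decide +kernel

theorem sum_norm_permContraction_four_le [∀ j, Nonempty (n j)]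
    (Δ : Matrix (∀ j, n j) (∀ j, n j) ℂ) :
    ∑ σ : ι → Equiv.Perm (Fin 4), ‖permContraction Δ σ‖
      ≤ 18 ^ Fintype.card ι * multiNorm Δ ^ 4 := by
  have hq := partialTraceSq_nonneg Δ
  have h1 := sum_mul_fixedFactors_le card_perm_four_fixed_le_left (partialTraceSq Δ) hq
  have h2 := sum_mul_fixedFactors_le card_perm_four_fixed_le_right (partialTraceSq Δ) hq
  rw [← multiNorm_sq] at h1 h2
  -- AM-GM in the form $abcd\le(a^2b^2+c^2d^2)/2$.
  have h3 : ∀ σ : ι → Equiv.Perm (Fin 4), ‖permContraction Δ σ‖ ≤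
      (partialTraceSq Δ (fixedFactors σ 0) * partialTraceSq Δ (fixedFactors σ 1)
        + partialTraceSq Δ (fixedFactors σ 2) * partialTraceSq Δ (fixedFactors σ 3)) / 2 := by
    intro σ
    refine (norm_permContraction_le Δ σ).trans ?_
    rw [Fin.prod_univ_four]
    have hs := fun i => Real.sq_sqrt (hq (fixedFactors σ i))
    rw [← hs 0, ← hs 1, ← hs 2, ← hs 3]
    simp only [Real.sqrt_sq (Real.sqrt_nonneg _)]
    nlinarith [sq_nonneg (√(partialTraceSq Δ (fixedFactors σ 0))
      * √(partialTraceSq Δ (fixedFactors σ 1)) - √(partialTraceSq Δ (fixedFactors σ 2))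
      * √(partialTraceSq Δ (fixedFactors σ 3)))]
  refine (Finset.sum_le_sum fun σ _ => h3 σ).trans ?_
  rw [← Finset.sum_div, Finset.sum_add_distrib]
  push_cast at h1 h2
  nlinarith [h1, h2]

end Moments

/-! ### First absolute moment against second and fourth moments. -/

section AbsoluteMoment

variable {X : Type*} {w s : X → ℝ} {A B : ℝ}

theorem summable_mul_abs (hw : ∀ x, 0 ≤ w x) (h0 : HasSum w 1)
    (h2 : HasSum (fun x => w x * s x ^ 2) A) : Summable fun x => w x * |s x| := by
  refine Summable.of_nonneg_of_le (fun x => mul_nonneg (hw x) (abs_nonneg _)) (fun x => ?_)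
    (h0.summable.add h2.summable)
  nlinarith [hw x, mul_nonneg (hw x) (sq_nonneg (|s x| - 1)), sq_abs (s x),
    mul_nonneg (hw x) (abs_nonneg (s x))]

theorem mul_tsum_mul_abs_le (hw : ∀ x, 0 ≤ w x) (h0 : HasSum w 1)
    (h2 : HasSum (fun x => w x * s x ^ 2) A) (τ : ℝ) :
    2 * τ * ∑' x, w x * |s x| ≤ τ ^ 2 + A := by
  have h1 := (summable_mul_abs hw h0 h2).hasSum
  refine (hasSum_le (fun x => ?_) (h1.mul_left (2 * τ)) ((h0.mul_left (τ ^ 2)).add h2)).trans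
    (by simp)
  rw [← sq_abs (s x)]
  linarith [mul_nonneg (hw x) (sq_nonneg (|s x| - τ))]

/-- Averages $|s|(|s|-\tau)^2(|s|+2\tau)=s^4-3\tau^2s^2+2\tau^3|s|\ge0$; optimising τ recovers the
Hölder bound. -/
theorem le_mul_tsum_mul_abs_add (hw : ∀ x, 0 ≤ w x) (h0 : HasSum w 1)
    (h2 : HasSum (fun x => w x * s x ^ 2) A) (h4 : HasSum (fun x => w x * s x ^ 4) B) {τ : ℝ}
    (hτ : 0 ≤ τ) : 3 * τ ^ 2 * A ≤ 2 * τ ^ 3 * (∑' x, w x * |s x|) + B := by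
  have h1 := (summable_mul_abs hw h0 h2).hasSum
  refine hasSum_le (fun x => ?_) (h2.mul_left (3 * τ ^ 2)) ((h1.mul_left (2 * τ ^ 3)).add h4)
  have h := mul_nonneg (hw x) (mul_nonneg (mul_nonneg (abs_nonneg (s x)) (sq_nonneg (|s x| - τ)))
    (by positivity : 0 ≤ |s x| + 2 * τ))
  have e2 : s x ^ 2 = |s x| ^ 2 := (sq_abs _).symm
  have e4 : s x ^ 4 = |s x| ^ 4 := by rw [show (4 : ℕ) = 2 * 2 from rfl, pow_mul, pow_mul, e2]
  rw [e2, e4]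
  linarith [h]

end AbsoluteMoment

/-! ### Assembly of the two bounds. -/

section
theorem tensorProd_isHermitian {ι : Type*} [Fintype ι] {n : ι → Type*}
    {A : ∀ j, Matrix (n j) (n j) ℂ} (hA : ∀ j, (A j).IsHermitian) : (tensorProd A).IsHermitian := by
  ext a b
  simp only [tensorProd, Matrix.conjTranspose_apply, Matrix.of_apply, star_prod, (hA _).apply]

theorem trace_mul_eq_ofReal_re {m : Type*} [Fintype m] {A B : Matrix m m ℂ} (hA : A.IsHermitian)
    (hB : B.IsHermitian) : (A * B).trace = (((A * B).trace.re : ℝ) : ℂ) := by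
  refine (Complex.conj_eq_iff_re.mp ?_).symm
  rw [← RCLike.star_def, ← Matrix.trace_conjTranspose, Matrix.conjTranspose_mul, hA.eq, hB.eq,
    Matrix.trace_mul_comm]

section Empty

variable {ι : Type*} [Fintype ι] [DecidableEq ι] {n : ι → Type*} [∀ j, Fintype (n j)]

theorem multiNorm_eq_zero_of_isEmpty [IsEmpty (∀ j, n j)]
    (Δ : Matrix (∀ j, n j) (∀ j, n j) ℂ) : multiNorm Δ = 0 := by
  refine pow_eq_zero_iff two_ne_zero |>.mp ?_
  rw [multiNorm_sq]
  refine Finset.sum_eq_zero fun I _ => ?_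
  rw [partialTraceSq_eq_sum]
  refine Finset.sum_eq_zero fun c _ => Finset.sum_eq_zero fun r _ => ?_
  have : partialTrace I Δ r c = 0 := Finset.sum_eq_zero fun z _ =>
    isEmptyElim ((Equiv.piEquivPiSubtypeProd (fun j => j ∈ I) n).symm (z, r))
  simp [this]

theorem measurementNorm_eq_zero_of_isEmpty {X m : Type*} [Fintype m] [IsEmpty m]
    (M : X → Matrix m m ℂ) (Δ : Matrix m m ℂ) : measurementNorm M Δ = 0 := by
  simp [measurementNorm, Matrix.trace]

end Empty

variable {K : ℕ} {n : Fin K → Type*} [∀ j, Fintype (n j)] [∀ j, DecidableEq (n j)]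
    {X : Fin K → Type*} {M : ∀ j, X j → Matrix (n j) (n j) ℂ}

/-- The probabilities and expectation values of the product measurement: `measurementNorm` is the
total dimension times an absolute first moment whose second moment is known and whose fourth moment
is controlled by `multiNorm`. -/
theorem exists_moments [∀ j, Nonempty (n j)] (hM : ∀ j, IsDesign 4 (M j))
    {Δ : Matrix (∀ j, n j) (∀ j, n j) ℂ} (hΔ : Δ.IsHermitian) :
    ∃ (w s : (∀ j, X j) → ℝ) (B : ℝ), (∀ x, 0 ≤ w x) ∧ HasSum w 1 ∧
      HasSum (fun x => w x * s x ^ 2)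
        ((∏ j, ((Fintype.card (n j)).ascFactorial 2 : ℝ)⁻¹) * multiNorm Δ ^ 2) ∧
      HasSum (fun x => w x * s x ^ 4) B ∧
      B ≤ (∏ j, ((Fintype.card (n j)).ascFactorial 4 : ℝ)⁻¹) * (18 ^ K * multiNorm Δ ^ 4) ∧
      measurementNorm (tensorPOVM M) Δ
        = (∏ j, (Fintype.card (n j) : ℝ)) * ∑' x, w x * |s x| := by
  let P : ∀ x : ∀ j, X j, Matrix (∀ j, n j) (∀ j, n j) ℂ := fun x =>
    tensorProd fun j => (M j (x j)).trace⁻¹ • M j (x j)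
  let m : ∀ j, X j → ℝ := fun j y => (M j y).trace.re
  have hm0 : ∀ j y, 0 ≤ m j y := fun j y =>
    (Complex.nonneg_iff.mp ((hM j).posSemidef y).trace_nonneg).1
  have hm : ∀ j y, (M j y).trace = m j y := fun j y =>
    (Complex.ext rfl (Complex.nonneg_iff.mp ((hM j).posSemidef y).trace_nonneg).2.symm)
  have hP : ∀ x, (P x).IsHermitian := by
    refine fun x => tensorProd_isHermitian fun j => ?_
    rw [hm, ← Complex.ofReal_inv]
    ext a b
    simp [((hM j).posSemidef (x j)).isHermitian.apply a b]
  let w : (∀ j, X j) → ℝ := fun x => ∏ j, m j (x j) / (Fintype.card (n j) : ℝ)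
  let s : (∀ j, X j) → ℝ := fun x => (Δ * P x).trace.re
  have hs : ∀ x, (Δ * P x).trace = s x := fun x => trace_mul_eq_ofReal_re hΔ (hP x)
  have hw : ∀ x, (∏ j, (M j (x j)).trace / (Fintype.card (n j) : ℂ)) = w x := by
    intro x
    simp only [hm, w]
    push_cast
    rfl
  have key : ∀ t ≤ 4, HasSum (fun x => w x * s x ^ t)
      ((∏ j, ((Fintype.card (n j)).ascFactorial t : ℝ)⁻¹) *
        (∑ σ : Fin K → Equiv.Perm (Fin t), permContraction Δ σ).re) := by
    intro t ht
    have h := Complex.hasSum_re (hasSum_weight_mul_pow hM ht Δ)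
    convert h using 1
    · ext x
      rw [hw, show (Δ * tensorProd fun j => (M j (x j)).trace⁻¹ • M j (x j)).trace = s x from hs x]
      norm_cast
    · have : (∏ j, ((Fintype.card (n j)).ascFactorial t : ℂ)⁻¹)
          = ((∏ j, ((Fintype.card (n j)).ascFactorial t : ℝ)⁻¹ : ℝ) : ℂ) := by push_cast; rfl
      rw [this, Complex.re_ofReal_mul]
  refine ⟨w, s, _, fun x => Finset.prod_nonneg fun j _ => div_nonneg (hm0 _ _) (Nat.cast_nonneg _),
    ?_, ?_, key 4 le_rfl, ?_, ?_⟩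
  -- With no copies the contraction is 1, so the zeroth moment is the total weight.
  · simpa [permContraction] using key 0 (by norm_num)
  · have h := key 2 (by norm_num)
    rwa [sum_permContraction_two hΔ, Complex.ofReal_re] at h
  · refine mul_le_mul_of_nonneg_left ?_ (Finset.prod_nonneg fun j _ => by positivity)
    refine (Complex.re_le_norm _).trans ((norm_sum_le _ _).trans ?_)
    simpa using sum_norm_permContraction_four_le Δ
  · rw [measurementNorm, ← tsum_mul_left]
    refine tsum_congr fun x => ?_
    have h1 : tensorPOVM M x = (∏ j, (m j (x j) : ℂ)) • P x := by
      ext a b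
      simp only [tensorPOVM, P, tensorProd, Matrix.of_apply, Matrix.smul_apply, smul_eq_mul,
        ← Finset.prod_mul_distrib, hm]
      refine Finset.prod_congr rfl fun j _ => ?_
      rw [mul_inv_cancel_left₀ (hm j (x j) ▸ (hM j).trace_ne_zero (x j))]
    rw [h1, Matrix.mul_smul, Matrix.trace_smul, hs, norm_smul, Complex.norm_real, Real.norm_eq_abs,
      ← mul_assoc, ← Finset.prod_mul_distrib, norm_prod]
    congr 1
    refine Finset.prod_congr rfl fun j _ => ?_
    have hd : (Fintype.card (n j) : ℝ) ≠ 0 := by exact_mod_cast Fintype.card_ne_zero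
    rw [Complex.norm_real, Real.norm_of_nonneg (hm0 _ _), mul_div_cancel₀ _ hd]

/-- Here $\tau=N/(\kappa D_1)$, so $\tau^2$ is the ratio of the fourth-moment bound to the second
moment. -/
theorem le_of_moment_inequality {D D₁ N E B κ Q : ℝ} (hD : 0 < D) (hD₁ : 0 < D₁) (hN : 0 < N)
    (hκ : 0 < κ) (hQ : κ ^ 2 * Q = 1) (hB : B ≤ Q * N ^ 4 / (D * D₁ ^ 3))
    (h : 3 * (N / (κ * D₁)) ^ 2 * (N ^ 2 / (D * D₁)) ≤ 2 * (N / (κ * D₁)) ^ 3 * E + B) :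
    κ * N ≤ D * E := by
  have hQ' : Q = 1 / κ ^ 2 := by field_simp; linarith
  rw [hQ'] at hB
  have h1 : (N ^ 3 / (κ ^ 3 * D₁ ^ 3 * D)) * (κ * N) ≤ (N ^ 3 / (κ ^ 3 * D₁ ^ 3 * D)) * (D * E) := by
    have e1 : 3 * (N / (κ * D₁)) ^ 2 * (N ^ 2 / (D * D₁))
        = 3 * ((N ^ 3 / (κ ^ 3 * D₁ ^ 3 * D)) * (κ * N)) := by field_simp
    have e2 : 1 / κ ^ 2 * N ^ 4 / (D * D₁ ^ 3) = (N ^ 3 / (κ ^ 3 * D₁ ^ 3 * D)) * (κ * N) := by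
      field_simp
    have e3 : 2 * (N / (κ * D₁)) ^ 3 * E = 2 * ((N ^ 3 / (κ ^ 3 * D₁ ^ 3 * D)) * (D * E)) := by
      field_simp
    rw [e1, e3] at h
    rw [e2] at hB
    linarith
  exact le_of_mul_le_mul_left h1 (by positivity)

theorem measurementNorm_tensorPOVM_bounds [∀ j, Nonempty (n j)] (hM : ∀ j, IsDesign 4 (M j))
    {Δ : Matrix (∀ j, n j) (∀ j, n j) ℂ} (hΔ : Δ.IsHermitian) :
    √(1 / 18 : ℝ) ^ K * multiNorm Δ ≤ measurementNorm (tensorPOVM M) Δ ∧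
      measurementNorm (tensorPOVM M) Δ ≤ multiNorm Δ := by
  obtain ⟨w, s, B, hw, h0, h2, h4, hB, hnorm⟩ := exists_moments hM hΔ
  set N := multiNorm Δ
  have hN : 0 ≤ N := multiNorm_nonneg Δ
  have hd : ∀ j, (0 : ℝ) < Fintype.card (n j) := fun j => by exact_mod_cast Fintype.card_pos
  set D : ℝ := ∏ j, (Fintype.card (n j) : ℝ)
  set D₁ : ℝ := ∏ j, ((Fintype.card (n j) : ℝ) + 1)
  have hD : 0 < D := Finset.prod_pos fun j _ => hd j
  have hD₁ : 0 < D₁ := Finset.prod_pos fun j _ => add_pos (hd j) one_pos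
  have hDD₁ : D ≤ D₁ := Finset.prod_le_prod (fun j _ => (hd j).le) fun j _ => by linarith
  have hasc2 : ∏ j, ((Fintype.card (n j)).ascFactorial 2 : ℝ)⁻¹ = 1 / (D * D₁) := by
    rw [← Finset.prod_mul_distrib, one_div, ← Finset.prod_inv_distrib]
    refine Finset.prod_congr rfl fun j _ => ?_
    simp only [Nat.ascFactorial]
    push_cast
    ring_nf
  -- Uses $(d+2)(d+3)\ge(d+1)^2$.
  have hasc4 : ∏ j, ((Fintype.card (n j)).ascFactorial 4 : ℝ)⁻¹ ≤ 1 / (D * D₁ ^ 3) := by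
    rw [← Finset.prod_pow, ← Finset.prod_mul_distrib, one_div, ← Finset.prod_inv_distrib]
    refine Finset.prod_le_prod (fun j _ => by positivity) fun j _ => ?_
    have := hd j
    refine inv_anti₀ (by positivity) ?_
    simp only [Nat.ascFactorial]
    push_cast
    generalize (Fintype.card (n j) : ℝ) = d at this ⊢
    nlinarith [mul_nonneg (mul_nonneg this.le (by linarith : 0 ≤ d + 1)) this.le,
      mul_nonneg this.le (by linarith : 0 ≤ d + 1)]
  have hA : (∏ j, ((Fintype.card (n j)).ascFactorial 2 : ℝ)⁻¹) * N ^ 2 = N ^ 2 / (D * D₁) := by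
    rw [hasc2]
    ring
  rw [hA] at h2
  rw [hnorm]
  constructor
  · rcases hN.eq_or_lt with h | h
    · rw [← h, mul_zero]
      exact mul_nonneg hD.le (tsum_nonneg fun x => mul_nonneg (hw x) (abs_nonneg _))
    · refine le_of_moment_inequality (Q := 18 ^ K) (B := B) hD hD₁ h (by positivity) ?_ ?_
        (le_mul_tsum_mul_abs_add hw h0 h2 h4 (by positivity))
      · rw [← pow_mul, mul_comm K 2, pow_mul, Real.sq_sqrt (by norm_num), ← mul_pow]
        norm_num
      · refine hB.trans ((mul_le_mul_of_nonneg_right hasc4 (by positivity)).trans (le_of_eq ?_))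
        ring
  -- The ε keeps τ positive even when $N=0$.
  · refine le_of_forall_pos_le_add fun ε hε => ?_
    have h := mul_tsum_mul_abs_le hw h0 h2 ((N + ε) / D)
    have hA' : N ^ 2 / (D * D₁) ≤ ((N + ε) / D) ^ 2 := by
      rw [div_pow, sq D]
      exact div_le_div₀ (by positivity) (by nlinarith) (by positivity)
        (mul_le_mul_of_nonneg_left hDD₁ hD.le)
    have hτ : 0 < (N + ε) / D := by positivity
    have h1 : ∑' x, w x * |s x| ≤ (N + ε) / D := by
      refine le_of_mul_le_mul_left (a := 2 * ((N + ε) / D)) ?_ (by positivity)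
      linarith
    calc D * ∑' x, w x * |s x| ≤ D * ((N + ε) / D) := mul_le_mul_of_nonneg_left h1 hD.le
      _ = N + ε := mul_div_cancel₀ _ hD.ne'

end

end DesignPOVM

theorem theorem2 {K : ℕ} {n : Fin K → Type*} [∀ j, Fintype (n j)] [∀ j, DecidableEq (n j)]
    {X : Fin K → Type*} (M : ∀ j, X j → Matrix (n j) (n j) ℂ)
    (hM : ∀ j, DesignPOVM.IsDesign 4 (M j))
    (Δ : Matrix (∀ j, n j) (∀ j, n j) ℂ) (hΔ : Δ.IsHermitian) :
    √(1 / 18 : ℝ) ^ K * DesignPOVM.multiNorm Δ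
        ≤ DesignPOVM.measurementNorm (DesignPOVM.tensorPOVM M) Δ ∧
      DesignPOVM.measurementNorm (DesignPOVM.tensorPOVM M) Δ ≤ DesignPOVM.multiNorm Δ := by
  -- A zero-dimensional factor makes both norms vanish; the sphere moments need positive dimensions.
  rcases isEmpty_or_nonempty (∀ j, n j) with h | h
  · rw [DesignPOVM.multiNorm_eq_zero_of_isEmpty, DesignPOVM.measurementNorm_eq_zero_of_isEmpty]
    simp
  · have : ∀ j, Nonempty (n j) := fun j => h.map fun a => a j
    exact DesignPOVM.measurementNorm_tensorPOVM_bounds hM hΔ
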